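/- Let $B_n$ be the hyperoctahedral group of signed permutations $\pi=\pi_1\cdots\pi_n$, i.e. words with letters $\pi_i\in\{\pm1,\dots,\pm n\}$ such that $|\pi_1|\cdots|\pi_n|$ is a permutation of $[n]=\{1,\dots,n\}$. Let $\ell_B(\pi)$ be the Coxeter length of $\pi$, that is, the least number of factors in an expression of $\pi$ as a product of the generators $s_0,s_1,\dots,s_{n-1}$, where $s_0$ is the sign change of $1$ and $s_i=(i,i+1)$ for $1\le i\le n-1$ (right multiplication by $s_0$ changes the sign of $\pi_1$, right multiplication by $s_i$ swaps $\pi_i$ and $\pi_{i+1}$). Let $$\mathrm{fmaj}(\pi)=2\sum_{1\le i\le n-1,\ \pi_{i+1}\prec\pi_i} i\;+\;\#\{i\in[n]:\pi_i<0\},$$ where $\prec$ is the order $-1\prec-2\prec\cdots\prec-n\prec0\prec1\prec2\prec\cdots\prec n$. The derangement part $dp(\pi)$ is obtained from the subword of $\pi$ formed by the letters $\pi_i$ with $\pi_i\ne i$ by reduction: if $a_1<\cdots<a_m$ are the absolute values of the letters of this subword, each letter $\pm a_j$ is replaced by $\pm j$. Let $\mathcal D^{\Delta}_k$ be the set of $\sigma\in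 B_k$ with $\sigma_i\neq i$ for all $i\in[k]$ and $\sigma_k>0$, and let $\Delta^{<}_n=\{\pi\in B_n: 0<\pi_n<n\}$. Let $\varepsilon=\pm1$, $1\le k\le n$ and $\sigma\in\mathcal D^{\Delta}_k$. Then, as an identity in the indeterminate $q$, $$\sum_{\pi\in\Delta^{<}_n,\ dp(\pi)=\sigma}\varepsilon^{\ell_B(\pi)}q^{\mathrm{fmaj}(\pi)}=\varepsilon^{\ell_B(\sigma)}\,q^{2(n-k)+\mathrm{fmaj}(\sigma)}{n-1\brack k-1}_{q^2},$$ where ${m\brack j}_q=\dfrac{[m]_q!}{[j]_q!\,[m-j]_q!}$, $[m]_q!=[1]_q[2]_q\cdots[m]_q$ (so $[0]_q!=1$) and $[i]_q=1+q+\cdots+q^{i-1}$. -/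

import Mathlib

namespace SignedMahonian

/-- The hyperoctahedral group `B_n`, as the finite set of its signed words `π_1 ⋯ π_n`:
the letters are integers and `|π_1| ⋯ |π_n|` is a permutation of `{1, …, n}`.
The letter `π_j` is `π i` for the index `i : Fin n` of value `j - 1`. -/
noncomputable def B (n : ℕ) : Finset (Fin n → ℤ) :=
  (Fintype.piFinset fun _ : Fin n => Finset.Icc (-(n : ℤ)) (n : ℤ)).filter
    fun π => Finset.univ.image (fun i => (π i).natAbs) = Finset.Icc 1 n

/-- The position `i` (counted from `1`) is a fixed point of `π`: `π_i = i`. -/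
def IsFixed {n : ℕ} (π : Fin n → ℤ) (i : Fin n) : Prop :=
  π i = ((i : ℕ) : ℤ) + 1

instance {n : ℕ} (π : Fin n → ℤ) (i : Fin n) : Decidable (IsFixed π i) :=
  inferInstanceAs (Decidable (π i = ((i : ℕ) : ℤ) + 1))

/-- `Neg(π)`: the set of positions of negative letters. -/
def negSet {n : ℕ} (π : Fin n → ℤ) : Finset (Fin n) :=
  Finset.univ.filter fun i => π i < 0

/-- `neg(π)`: the number of negative letters. -/
def neg {n : ℕ} (π : Fin n → ℤ) : ℕ := (negSet π).card

/-- `IsProduct m π`: the signed permutation `π` is a product of `m` of the Coxeter generators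
`s_0, s_1, …, s_{n-1}` of `B_n`. Here `s_i`, for `1 ≤ i ≤ n - 1`, is the transposition of `i`
and `i + 1`, and multiplying by it on the right swaps the letters `π_i` and `π_{i+1}`; `s_0` is
the sign change of `1`, and multiplying by it on the right changes the sign of `π_1`. -/
inductive IsProduct {n : ℕ} : ℕ → (Fin n → ℤ) → Prop
  | one : IsProduct 0 (fun i => ((i : ℕ) : ℤ) + 1)
  | mul_swap {m : ℕ} {π : Fin n → ℤ} (i j : Fin n) (hij : (j : ℕ) = (i : ℕ) + 1)
      (h : IsProduct m π) : IsProduct (m + 1) (π ∘ Equiv.swap i j)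
  | mul_neg {m : ℕ} {π : Fin n → ℤ} (i : Fin n) (hi : (i : ℕ) = 0)
      (h : IsProduct m π) : IsProduct (m + 1) (Function.update π i (-π i))

/-- The Coxeter length `ℓ_B(π)`: the least number of generators whose product is `π`. -/
noncomputable def lengthB {n : ℕ} (π : Fin n → ℤ) : ℕ := sInf {m : ℕ | IsProduct m π}

/-- The strict linear order `-1 ≺ -2 ≺ ⋯ ≺ 0 ≺ 1 ≺ 2 ≺ ⋯` on `ℤ`. -/
def Prec (a b : ℤ) : Prop :=
  (a < 0 ∧ b < 0 ∧ b < a) ∨ (a < 0 ∧ 0 ≤ b) ∨ (0 ≤ a ∧ a < b)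

instance (a b : ℤ) : Decidable (Prec a b) :=
  inferInstanceAs (Decidable ((a < 0 ∧ b < 0 ∧ b < a) ∨ (a < 0 ∧ 0 ≤ b) ∨ (0 ≤ a ∧ a < b)))

/-- The descent set with respect to `≺`: the positions `i` (with `i + 1` also a position)
such that `π_{i+1} ≺ π_i`. -/
def desSet {n : ℕ} (π : Fin n → ℤ) : Finset (Fin n) :=
  Finset.univ.filter fun i => ∃ h : (i : ℕ) + 1 < n, Prec (π ⟨(i : ℕ) + 1, h⟩) (π i)

/-- `maj(π)` with respect to `≺`: the sum of the descents, positions being counted from `1`. -/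
def maj {n : ℕ} (π : Fin n → ℤ) : ℕ := ∑ i ∈ desSet π, ((i : ℕ) + 1)

/-- The flag major index `fmaj(π) = 2 maj(π) + neg(π)`. -/
def fmaj {n : ℕ} (π : Fin n → ℤ) : ℕ := 2 * maj π + neg π

/-- The reduction of a signed word with letters of distinct absolute values
`a_1 < ⋯ < a_m`: each letter `± a_j` is replaced by `± j`. -/
def reduction (w : List ℤ) : List ℤ :=
  w.map fun a => a.sign * (w.countP fun b => decide (b.natAbs ≤ a.natAbs) : ℕ)

/-- The subword of `π` formed by its non-fixed points. -/
def nonFixedSubword {n : ℕ} (π : Fin n → ℤ) : List ℤ :=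
  ((List.finRange n).filter fun i => decide (¬ IsFixed π i)).map π

/-- The derangement part `dp(π)`, as a signed word. -/
def dp {n : ℕ} (π : Fin n → ℤ) : List ℤ := reduction (nonFixedSubword π)

/-- `𝒟^Δ_n`: the signed derangements in `B_n` whose last letter is positive. -/
noncomputable def derangementsDelta (n : ℕ) : Finset (Fin n → ℤ) :=
  (B n).filter fun σ =>
    (∀ i, ¬ IsFixed σ i) ∧ ∃ i : Fin n, (i : ℕ) + 1 = n ∧ 0 < σ i

/-- `Δ^<_n`: the signed permutations in `B_n` whose last letter satisfies `0 < π_n < n`. -/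
noncomputable def deltaLt (n : ℕ) : Finset (Fin n → ℤ) :=
  (B n).filter fun π => ∃ i : Fin n, (i : ℕ) + 1 = n ∧ 0 < π i ∧ π i < (n : ℤ)

/-- `[m]_q = 1 + q + ⋯ + q^{m-1}`. -/
def qInt {K : Type*} [Field K] (q : K) (m : ℕ) : K := ∑ i ∈ Finset.range m, q ^ i

/-- `[m]_q! = [1]_q [2]_q ⋯ [m]_q`. -/
def qFactorial {K : Type*} [Field K] (q : K) (m : ℕ) : K :=
  ∏ i ∈ Finset.range m, qInt q (i + 1)

/-- The `q`-binomial coefficient `[m]_q! / ([j]_q! [m-j]_q!)`, for `j ≤ m`. -/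
def qBinomial {K : Type*} [Field K] (q : K) (m j : ℕ) : K :=
  qFactorial q m / (qFactorial q j * qFactorial q (m - j))

end SignedMahonian

/-! A signed permutation `π` with `dp π = σ` is determined by its set of non-fixed positions: it is
obtained from `σ` by transport along the increasing bijection onto that set, all other positions
being fixed (`inflate`). Every `k`-subset of positions occurs. Since the last letter of `σ` is
positive, `0 < π_n < n` holds exactly when `n` lies in the set, so the fiber is indexed by the
`(k-1)`-subsets of the first `n - 1` positions (`sum_fiber_eq`).

Inflation preserves the number of negative letters. It also preserves the character sending every
Coxeter generator to `-1`, which computes `(-1)^ℓ_B` (`neg_one_pow_lengthB`). Hence only `maj`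
varies over the fiber.

Whether `π` has a descent at a position depends only on the set, on the descents of `σ`, and on its
subcedants, the positions carrying a smaller letter (`prec_inflate_iff`). Summing `q^maj` over the
sets gives a recursion with two states, according to whether the last position is fixed. Both Pascal
rules together solve it (`endSums_eq`). With a non-fixed last position the result is `q^maj(σ)`
times a Gaussian binomial, and times a further `q^(n-k)` when the last letter of `σ` is a subcedant.
It is one here, being positive and different from `k`. Replacing `q` by `q²` gives the theorem. -/

namespace SignedMahonian

/-! ### Gaussian binomial coefficients -/

/-- The Gaussian binomial coefficient, defined by a `q`-Pascal recurrence. -/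
def gaussBinom {R : Type*} [CommRing R] (q : R) : ℕ → ℕ → R
  | _, 0 => 1
  | 0, _ + 1 => 0
  | n + 1, k + 1 => gaussBinom q n k + q ^ (k + 1) * gaussBinom q n (k + 1)

section Gauss

variable {R : Type*} [CommRing R] (q : R)

@[simp] lemma gaussBinom_zero_right (n : ℕ) : gaussBinom q n 0 = 1 := by
  cases n <;> rfl

@[simp] lemma gaussBinom_zero_succ (k : ℕ) : gaussBinom q 0 (k + 1) = 0 := rfl

lemma gaussBinom_succ_succ (n k : ℕ) :
    gaussBinom q (n + 1) (k + 1) = gaussBinom q n k + q ^ (k + 1) * gaussBinom q n (k + 1) := rfl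

lemma gaussBinom_eq_zero_of_lt {n k : ℕ} (h : n < k) : gaussBinom q n k = 0 := by
  induction n generalizing k with
  | zero => obtain ⟨k, rfl⟩ := Nat.exists_eq_succ_of_ne_zero h.ne'; rfl
  | succ n ih =>
    obtain ⟨k, rfl⟩ := Nat.exists_eq_succ_of_ne_zero (Nat.ne_zero_of_lt h)
    rw [Nat.succ_eq_add_one, gaussBinom_succ_succ, ih (by omega), ih (by omega)]
    simp

/-- The mirror Pascal rule. The truncation of `n - k` is harmless: for `n < k` the coefficient it
multiplies vanishes. -/
lemma gaussBinom_succ_succ' (n k : ℕ) :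
    gaussBinom q (n + 1) (k + 1) = q ^ (n - k) * gaussBinom q n k + gaussBinom q n (k + 1) := by
  induction n generalizing k with
  | zero =>
    cases k <;> simp [gaussBinom_succ_succ]
  | succ n ih =>
    rw [gaussBinom_succ_succ]
    rcases k with _ | k
    · have h1 := gaussBinom_succ_succ q n 0
      have h2 := ih 0
      simp only [gaussBinom_zero_right, Nat.sub_zero] at h1 h2 ⊢
      linear_combination (q - 1) * h2 + h2 - h1
    · rcases lt_or_ge n (k + 1) with h | h
      · rw [gaussBinom_eq_zero_of_lt q (show n + 1 < k + 1 + 1 by omega)]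
        rcases (show n = k ∨ n < k by omega) with rfl | h'
        · simp
        · rw [gaussBinom_eq_zero_of_lt q (show n + 1 < k + 1 by omega)]; simp
      · have h1 := ih k
        have h2 := ih (k + 1)
        have h3 := gaussBinom_succ_succ q n k
        have h4 := gaussBinom_succ_succ q n (k + 1)
        obtain ⟨m, rfl⟩ := Nat.exists_eq_add_of_le h
        rw [show k + 1 + m - k = m + 1 by omega] at h1
        rw [show k + 1 + m - (k + 1) = m by omega] at h2
        rw [show k + 1 + m + 1 - (k + 1) = m + 1 by omega]
        linear_combination h1 + q ^ (k + 2) * h2 - q ^ (m + 1) * h3 - h4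

end Gauss

section GaussField

variable {K : Type*} [Field K] (q : K)

lemma qInt_add (a b : ℕ) : qInt q (a + b) = qInt q a + q ^ a * qInt q b := by
  simp [qInt, Finset.sum_range_add, Finset.mul_sum, pow_add]

lemma qFactorial_succ (m : ℕ) : qFactorial q (m + 1) = qFactorial q m * qInt q (m + 1) := by
  simp [qFactorial, Finset.prod_range_succ]

/-- The Pascal rule matches the splitting `[a + b] = [a] + q^a [b]` of the last factor of the
factorial. Stated without division, it needs no assumption on `q`. -/
lemma gaussBinom_mul_qFactorial (k m : ℕ) :
    gaussBinom q (k + m) k * (qFactorial q k * qFactorial q m) = qFactorial q (k + m) := by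
  induction k generalizing m with
  | zero => simp [qFactorial]
  | succ k ihk =>
    induction m with
    | zero =>
      have h := ihk 0
      rw [Nat.add_zero] at h ⊢
      rw [gaussBinom_succ_succ, gaussBinom_eq_zero_of_lt q (Nat.lt_succ_self k), qFactorial_succ]
      linear_combination qInt q (k + 1) * h
    | succ m ihm =>
      have h := ihk (m + 1)
      rw [show k + 1 + (m + 1) = (k + (m + 1)) + 1 by ring, gaussBinom_succ_succ,
        qFactorial_succ q (k + (m + 1)), qFactorial_succ q k, qFactorial_succ q m,
        show qInt q (k + (m + 1) + 1) = qInt q (k + 1) + q ^ (k + 1) * qInt q (m + 1) by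
          rw [← qInt_add]; congr 1; ring]
      rw [show k + 1 + m = k + (m + 1) by ring, qFactorial_succ q k] at ihm
      rw [qFactorial_succ q m] at h
      linear_combination qInt q (k + 1) * h + q ^ (k + 1) * qInt q (m + 1) * ihm

lemma gaussBinom_eq_qBinomial (hq : ∀ m, qInt q (m + 1) ≠ 0) {n k : ℕ} (h : k ≤ n) :
    gaussBinom q n k = qBinomial q n k := by
  have hf (m : ℕ) : qFactorial q m ≠ 0 := Finset.prod_ne_zero_iff.2 fun i _ => hq i
  obtain ⟨m, rfl⟩ := Nat.exists_eq_add_of_le h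
  rw [qBinomial, Nat.add_sub_cancel_left, eq_div_iff (mul_ne_zero (hf _) (hf _)),
    gaussBinom_mul_qFactorial]

end GaussField

/-- The underlying polynomial takes the value `m + 1` at `1`. -/
lemma qInt_X_sq_ne_zero (m : ℕ) : qInt ((RatFunc.X : RatFunc ℚ) ^ 2) (m + 1) ≠ 0 := by
  have h : qInt ((RatFunc.X : RatFunc ℚ) ^ 2) (m + 1) =
      algebraMap (Polynomial ℚ) (RatFunc ℚ)
        (∑ i ∈ Finset.range (m + 1), (Polynomial.X ^ 2) ^ i) := by
    simp [qInt]
  rw [h]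
  refine RatFunc.algebraMap_ne_zero fun h0 => ?_
  have := congrArg (Polynomial.eval 1) h0
  simp only [Polynomial.eval_finsetSum, Polynomial.eval_pow, Polynomial.eval_X, one_pow,
    Finset.sum_const, Finset.card_range, nsmul_eq_mul, mul_one, Polynomial.eval_zero] at this
  exact absurd this (by positivity)

/-! ### Major index of a word with inserted fixed points -/

/-- The descents of a word obtained by inserting fixed points into a word without fixed points:
`S` is the set of non-fixed positions, `d j` says that the short word has a descent at `j`, and
`t j` that its letter at `j` lies below its position. -/
def PatternDescent (t d : ℕ → Prop) (S : Finset ℕ) (i : ℕ) : Prop :=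
  (i ∈ S ∧ i + 1 ∈ S ∧ d (S.filter (· < i)).card) ∨
  (i ∈ S ∧ i + 1 ∉ S ∧ ¬ t (S.filter (· < i)).card) ∨
  (i ∉ S ∧ i + 1 ∈ S ∧ t (S.filter (· < i)).card)

open Classical in
/-- The major index attached to `PatternDescent`, for words of length `n + 1`. -/
noncomputable def patternMaj (t d : ℕ → Prop) (n : ℕ) (S : Finset ℕ) : ℕ :=
  ∑ i ∈ Finset.range n, if PatternDescent t d S i then i + 1 else 0

section Pattern

variable {t d : ℕ → Prop}

lemma PatternDescent.congr {S T : Finset ℕ} {i : ℕ} (h : ∀ j ≤ i + 1, j ∈ S ↔ j ∈ T) :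
    PatternDescent t d S i ↔ PatternDescent t d T i := by
  have hf : S.filter (· < i) = T.filter (· < i) := by
    ext j
    simp only [Finset.mem_filter]
    constructor
    · rintro ⟨h1, h2⟩; exact ⟨(h j (by omega)).1 h1, h2⟩
    · rintro ⟨h1, h2⟩; exact ⟨(h j (by omega)).2 h1, h2⟩
  simp only [PatternDescent, hf, h i (by omega), h (i + 1) le_rfl]

open Classical in
lemma patternMaj_congr {S T : Finset ℕ} {n : ℕ} (h : ∀ j ≤ n, j ∈ S ↔ j ∈ T) :
    patternMaj t d n S = patternMaj t d n T := by
  refine Finset.sum_congr rfl fun i hi => ?_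
  rw [Finset.mem_range] at hi
  have := PatternDescent.congr (t := t) (d := d) (S := S) (T := T) (i := i)
    fun j hj => h j (by omega)
  exact if_congr this rfl rfl

variable (t d)

open Classical in
lemma patternMaj_succ (n : ℕ) (S : Finset ℕ) :
    patternMaj t d (n + 1) S =
      patternMaj t d n S + if PatternDescent t d S n then n + 1 else 0 := by
  rw [patternMaj, Finset.sum_range_succ, patternMaj]

variable {R : Type*} [CommRing R] (q : R)

/-- The generating function of patterns of length `n + 1` with `k` non-fixed points and a final
fixed point. -/
noncomputable def fixedEndSum (n k : ℕ) : R :=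
  ∑ S ∈ Finset.powersetCard k (Finset.range n), q ^ patternMaj t d n S

/-- The generating function of patterns of length `n + 1` with `k + 1` non-fixed points, one of
them at the end. -/
noncomputable def nonfixedEndSum (n k : ℕ) : R :=
  ∑ S ∈ Finset.powersetCard k (Finset.range n), q ^ patternMaj t d n (insert n S)

lemma sum_powersetCard_range_succ (n k : ℕ) (f : Finset ℕ → R) :
    ∑ S ∈ Finset.powersetCard (k + 1) (Finset.range (n + 1)), f S =
      ∑ S ∈ Finset.powersetCard (k + 1) (Finset.range n), f S +
        ∑ S ∈ Finset.powersetCard k (Finset.range n), f (insert n S) := by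
  rw [Finset.range_add_one, Finset.powersetCard_succ_insert (by simp), Finset.sum_union,
    Finset.sum_image]
  · intro S hS T hT h
    rw [Finset.mem_coe, Finset.mem_powersetCard] at hS hT
    have h1 : n ∉ S := fun h => by simpa using hS.1 h
    have h2 : n ∉ T := fun h => by simpa using hT.1 h
    rw [← Finset.erase_insert h1, h, Finset.erase_insert h2]
  · rw [Finset.disjoint_left]
    intro S hS hS'
    obtain ⟨T, -, rfl⟩ := Finset.mem_image.1 hS'
    have := (Finset.mem_powersetCard.1 hS).1 (Finset.mem_insert_self n T)
    simp at this

variable {S : Finset ℕ} {n k : ℕ}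

lemma filter_lt_eq_self (hS : S ⊆ Finset.range n) : S.filter (· < n) = S :=
  Finset.filter_true_of_mem fun _ h => Finset.mem_range.1 (hS h)

open Classical in
lemma patternMaj_fixed_fixed (hS : S ⊆ Finset.range n) :
    patternMaj t d (n + 1) S = patternMaj t d n S := by
  have h1 : n ∉ S := fun h => by simpa using hS h
  have h2 : n + 1 ∉ S := fun h => by simpa using hS h
  simp [patternMaj_succ, PatternDescent, h1, h2]

open Classical in
lemma patternMaj_nonfixed_fixed (hS : S ⊆ Finset.range n) :
    patternMaj t d (n + 1) (insert n S) =
      patternMaj t d n (insert n S) + if t S.card then 0 else n + 1 := by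
  have h2 : n + 1 ∉ S := fun h => by simpa using hS h
  simp only [patternMaj_succ, PatternDescent, Finset.filter_insert, lt_irrefl, if_false,
    filter_lt_eq_self hS]
  simp [h2]

open Classical in
lemma patternMaj_fixed_nonfixed (hS : S ⊆ Finset.range n) :
    patternMaj t d (n + 1) (insert (n + 1) S) =
      patternMaj t d n S + if t S.card then n + 1 else 0 := by
  have h1 : n ∉ S := fun h => by simpa using hS h
  rw [patternMaj_succ, patternMaj_congr (T := S) fun j hj => by simp; omega]
  simp only [PatternDescent, Finset.filter_insert, filter_lt_eq_self hS]
  simp [h1]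

open Classical in
lemma patternMaj_nonfixed_nonfixed (hS : S ⊆ Finset.range n) :
    patternMaj t d (n + 1) (insert (n + 1) (insert n S)) =
      patternMaj t d n (insert n S) + if d S.card then n + 1 else 0 := by
  rw [patternMaj_succ, patternMaj_congr (T := insert n S) fun j hj => by simp; omega]
  simp only [PatternDescent, Finset.filter_insert, filter_lt_eq_self hS, lt_irrefl, if_false]
  simp

open Classical in
-- The sets are split according to whether the last but one position, of index `n`, is fixed; a
-- descent there contributes `n + 1`.
lemma fixedEndSum_succ_succ (n k : ℕ) :
    fixedEndSum t d q (n + 1) (k + 1) =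
      fixedEndSum t d q n (k + 1) +
        q ^ (if t k then 0 else n + 1) * nonfixedEndSum t d q n k := by
  rw [fixedEndSum, sum_powersetCard_range_succ, fixedEndSum, nonfixedEndSum, Finset.mul_sum]
  congr 1 <;> refine Finset.sum_congr rfl fun S hS => ?_ <;>
    obtain ⟨h1, h2⟩ := Finset.mem_powersetCard.1 hS
  · rw [patternMaj_fixed_fixed t d h1]
  · rw [patternMaj_nonfixed_fixed t d h1, h2, ← pow_add, add_comm]

open Classical in
lemma nonfixedEndSum_succ_zero (n : ℕ) :
    nonfixedEndSum t d q (n + 1) 0 = q ^ (if t 0 then n + 1 else 0) := by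
  have h := patternMaj_fixed_nonfixed t d (S := ∅) (n := n) (by simp)
  simp only [Finset.card_empty] at h
  have h0 : patternMaj t d n ∅ = 0 := by simp [patternMaj, PatternDescent]
  rw [nonfixedEndSum, Finset.powersetCard_zero, Finset.sum_singleton, h, h0, zero_add]
  congr

open Classical in
lemma nonfixedEndSum_succ_succ (n k : ℕ) :
    nonfixedEndSum t d q (n + 1) (k + 1) =
      q ^ (if t (k + 1) then n + 1 else 0) * fixedEndSum t d q n (k + 1) +
        q ^ (if d k then n + 1 else 0) * nonfixedEndSum t d q n k := by
  rw [nonfixedEndSum, sum_powersetCard_range_succ, fixedEndSum, nonfixedEndSum, Finset.mul_sum,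
    Finset.mul_sum]
  congr 1 <;> refine Finset.sum_congr rfl fun S hS => ?_ <;>
    obtain ⟨h1, h2⟩ := Finset.mem_powersetCard.1 hS
  · rw [patternMaj_fixed_nonfixed t d h1, h2, ← pow_add, add_comm]
  · rw [patternMaj_nonfixed_nonfixed t d h1, h2, ← pow_add, add_comm]

open Classical in
/-- The major index of the prefix of length `k + 1` of a word with descent predicate `d`. -/
noncomputable def prefixMaj (k : ℕ) : ℕ := ∑ j ∈ Finset.range k, if d j then j + 1 else 0

open Classical in
-- Simultaneous induction on the length. The hypotheses link descents and subcedants as in a word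
-- without fixed points: passing from a non-subcedant to a subcedant forces a descent, and the
-- reverse passage forbids one.
lemma endSums_eq (K : ℕ) (hd : ∀ j, j + 1 < K → ¬ t j → t (j + 1) → d j)
    (ha : ∀ j, j + 1 < K → t j → ¬ t (j + 1) → ¬ d j) (n : ℕ) :
    (∀ k < K, fixedEndSum t d q n (k + 1) =
      q ^ prefixMaj d k * q ^ (if t k then 0 else k + 1) * gaussBinom q n (k + 1)) ∧
    (∀ k < K, nonfixedEndSum t d q n k =
      q ^ prefixMaj d k * q ^ (if t k then n - k else 0) * gaussBinom q n k) := by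
  induction n with
  | zero =>
    refine ⟨fun k _ => by
      rw [fixedEndSum, Finset.powersetCard_eq_empty.2 (by simp)]; simp, fun k _ => ?_⟩
    cases k <;> simp [nonfixedEndSum, patternMaj, prefixMaj]
  | succ n ih =>
    obtain ⟨ihA, ihB⟩ := ih
    refine ⟨fun k hk => ?_, fun k hk => ?_⟩
    · rw [fixedEndSum_succ_succ, ihA k hk, ihB k hk]
      by_cases ht : t k
      · simp only [ht, if_true]
        rw [gaussBinom_succ_succ']
        ring
      · simp only [ht, if_false]
        rcases lt_or_ge n k with h | h
        · simp [gaussBinom_eq_zero_of_lt q h,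
            gaussBinom_eq_zero_of_lt q (show n < k + 1 by omega),
            gaussBinom_eq_zero_of_lt q (show n + 1 < k + 1 by omega)]
        · rw [gaussBinom_succ_succ']
          obtain ⟨m, rfl⟩ := Nat.exists_eq_add_of_le h
          rw [Nat.add_sub_cancel_left]
          ring
    · rcases k with _ | k
      · rw [nonfixedEndSum_succ_zero]
        simp [prefixMaj]
      · rw [nonfixedEndSum_succ_succ, ihA k (by omega), ihB k (by omega)]
        have hp : prefixMaj d (k + 1) = prefixMaj d k + if d k then k + 1 else 0 := by
          rw [prefixMaj, Finset.sum_range_succ, prefixMaj]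
        rw [hp]
        -- For `n < k` all coefficients vanish, so the truncated exponent `n - k` plays no role.
        rcases lt_or_ge n k with h | h
        · simp [gaussBinom_eq_zero_of_lt q h,
            gaussBinom_eq_zero_of_lt q (show n < k + 1 by omega),
            gaussBinom_eq_zero_of_lt q (show n + 1 < k + 1 by omega)]
        · have e1 := gaussBinom_succ_succ q n k
          have e2 := gaussBinom_succ_succ' q n k
          obtain ⟨m, rfl⟩ := Nat.exists_eq_add_of_le h
          rw [Nat.add_sub_cancel_left] at e2 ⊢
          rw [show k + m + 1 - (k + 1) = m by omega]
          have hd' := hd k (by omega)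
          have ha' := ha k (by omega)
          -- Of the eight cases, `hd'` and `ha'` exclude two; each of the other six is one of the
          -- two Pascal rules multiplied by a power of `q`.
          by_cases h1 : t k <;> by_cases h2 : t (k + 1) <;> by_cases h3 : d k <;>
            simp only [h1, h2, h3, if_true, if_false, not_true, not_false_iff, forall_true_left]
              at hd' ha' ⊢ <;> first | (rw [e1]; ring1) | (rw [e2]; ring1)

end Pattern

/-! ### Signed words and the parity of the Coxeter length -/

/-- The signed word with signs `s` and absolute values `τ_1 ⋯ τ_n` (the values of the
permutation `τ` of `Fin n` being shifted by one). -/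
def word {n : ℕ} (s : Fin n → ℤˣ) (τ : Equiv.Perm (Fin n)) (i : Fin n) : ℤ :=
  (s i : ℤ) * (((τ i : ℕ) : ℤ) + 1)

section Word

variable {n : ℕ}

lemma natAbs_word (s : Fin n → ℤˣ) (τ : Equiv.Perm (Fin n)) (i : Fin n) :
    (word s τ i).natAbs = (τ i : ℕ) + 1 := by
  rw [word, Int.natAbs_mul, Int.units_natAbs, one_mul]
  omega

lemma sign_word (s : Fin n → ℤˣ) (τ : Equiv.Perm (Fin n)) (i : Fin n) :
    (word s τ i).sign = s i := by
  rcases Int.units_eq_one_or (s i) with h | h <;> rw [word, h]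
  · rw [Units.val_one, one_mul]; exact Int.sign_eq_one_of_pos (by omega)
  · rw [Units.val_neg, Units.val_one, neg_one_mul]; exact Int.sign_eq_neg_one_of_neg (by omega)

lemma word_injective {s s' : Fin n → ℤˣ} {τ τ' : Equiv.Perm (Fin n)}
    (h : word s τ = word s' τ') : s = s' ∧ τ = τ' := by
  constructor
  · funext i
    have := congrArg Int.sign (congrFun h i)
    rwa [sign_word, sign_word, Units.val_inj] at this
  · ext i
    have := congrArg Int.natAbs (congrFun h i)
    rw [natAbs_word, natAbs_word] at this
    omega

lemma word_mem_B (s : Fin n → ℤˣ) (τ : Equiv.Perm (Fin n)) : word s τ ∈ B n := by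
  simp only [B, Finset.mem_filter, Fintype.mem_piFinset, natAbs_word]
  refine ⟨fun i => ?_, ?_⟩
  · have := natAbs_word s τ i
    have := (τ i).isLt
    rw [Finset.mem_Icc]
    omega
  · ext a
    simp only [Finset.mem_image, Finset.mem_univ, true_and, Finset.mem_Icc]
    constructor
    · rintro ⟨i, rfl⟩
      have := (τ i).isLt
      omega
    · rintro ⟨h1, h2⟩
      exact ⟨τ.symm ⟨a - 1, by omega⟩, by simp; omega⟩

lemma exists_word_of_mem_B {π : Fin n → ℤ} (h : π ∈ B n) : ∃ s τ, π = word s τ := by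
  simp only [B, Finset.mem_filter] at h
  have hm (i : Fin n) : 1 ≤ (π i).natAbs ∧ (π i).natAbs ≤ n := by
    rw [← Finset.mem_Icc, ← h.2]
    exact Finset.mem_image_of_mem _ (Finset.mem_univ i)
  let f (i : Fin n) : Fin n := ⟨(π i).natAbs - 1, by have := hm i; omega⟩
  have hf : Function.Surjective f := fun a => by
    have : (a : ℕ) + 1 ∈ Finset.Icc 1 n := by rw [Finset.mem_Icc]; omega
    rw [← h.2, Finset.mem_image] at this
    obtain ⟨i, -, hi⟩ := this
    exact ⟨i, Fin.ext (by simp only [f]; omega)⟩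
  refine ⟨fun i => if 0 < π i then 1 else -1,
    Equiv.ofBijective f (Finite.injective_iff_bijective.1 (Finite.injective_iff_surjective.2 hf)),
    funext fun i => ?_⟩
  have := hm i
  simp only [word, Equiv.ofBijective_apply, f]
  split_ifs with h0 <;> simp <;> omega

lemma word_comp_swap (s : Fin n → ℤˣ) (τ : Equiv.Perm (Fin n)) (i j : Fin n) :
    word s τ ∘ Equiv.swap i j = word (s ∘ Equiv.swap i j) (τ * Equiv.swap i j) := rfl

lemma update_word (s : Fin n → ℤˣ) (τ : Equiv.Perm (Fin n)) (i : Fin n) :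
    Function.update (word s τ) i (-word s τ i) = word (Function.update s i (-s i)) τ := by
  funext j
  rcases eq_or_ne j i with rfl | h
  · simp [word]
  · simp [word, h]

/-- The sign of a signed permutation as an element of a Coxeter group of type `B`. -/
def wordSign (s : Fin n → ℤˣ) (τ : Equiv.Perm (Fin n)) : ℤˣ :=
  Equiv.Perm.sign τ * ∏ i, s i

/-- Each generator flips `wordSign`: a swap through the sign of the permutation, a sign change
through the product of the signs. -/
lemma IsProduct.exists_word {m : ℕ} {π : Fin n → ℤ} (h : IsProduct m π) :
    ∃ s τ, π = word s τ ∧ wordSign s τ = (-1) ^ m := by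
  induction h with
  | one => exact ⟨1, 1, by funext i; simp [word], by simp [wordSign]⟩
  | mul_swap i j hij _ ih =>
    obtain ⟨s, τ, rfl, hs⟩ := ih
    refine ⟨_, _, word_comp_swap s τ i j, ?_⟩
    have hne : i ≠ j := fun h => by rw [h] at hij; omega
    rw [pow_succ, ← hs, wordSign, wordSign, Equiv.Perm.sign_mul, Equiv.Perm.sign_swap hne]
    simp only [Function.comp_apply, Equiv.prod_comp (Equiv.swap i j) s]
    simp
  | mul_neg i hi _ ih =>
    obtain ⟨s, τ, rfl, hs⟩ := ih
    refine ⟨_, _, update_word s τ i, ?_⟩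
    rw [pow_succ, ← hs, wordSign, wordSign, Finset.prod_update_of_mem (Finset.mem_univ i),
      ← Finset.mul_prod_erase _ s (Finset.mem_univ i), Finset.sdiff_singleton_eq_erase]
    simp

lemma eq_id_of_monotone {π : Fin n → ℤ} (h : π ∈ B n) (h0 : ∀ i : Fin n, (i : ℕ) = 0 → 0 < π i)
    (hlt : ∀ i j : Fin n, (j : ℕ) = i + 1 → π i < π j) : π = fun i : Fin n => ((i : ℕ) : ℤ) + 1 := by
  have hm : StrictMono π := by
    rcases n with _ | n
    · exact fun i => i.elim0
    · exact Fin.strictMono_iff_lt_succ.2 fun i => hlt _ _ (by simp)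
  have hpos (i : Fin n) : 0 < π i :=
    (h0 ⟨0, i.pos⟩ rfl).trans_le (hm.monotone (Fin.mk_le_of_le_val (Nat.zero_le _)))
  refine (StrictMono.range_inj hm fun i j hij => by simpa using hij).1 ?_
  obtain ⟨s, τ, rfl⟩ := exists_word_of_mem_B h
  have hw (i : Fin n) : word s τ i = ((τ i : ℕ) : ℤ) + 1 := by
    have := hpos i; have := natAbs_word s τ i; omega
  ext a
  simp only [Set.mem_range, hw]
  exact τ.exists_congr_left.trans (by simp)

lemma comp_swap_mem_B {π : Fin n → ℤ} (h : π ∈ B n) (i j : Fin n) : π ∘ Equiv.swap i j ∈ B n := by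
  obtain ⟨s, τ, rfl⟩ := exists_word_of_mem_B h
  rw [word_comp_swap]
  exact word_mem_B _ _

lemma update_neg_mem_B {π : Fin n → ℤ} (h : π ∈ B n) (i : Fin n) :
    Function.update π i (-π i) ∈ B n := by
  obtain ⟨s, τ, rfl⟩ := exists_word_of_mem_B h
  rw [update_word]
  exact word_mem_B _ _

/-- A weight which increases when a signed permutation is sorted by Coxeter generators. -/
def sortWeight (π : Fin n → ℤ) : ℤ := ∑ i : Fin n, ((i : ℕ) + 1 : ℤ) * π i

lemma sortWeight_le {π : Fin n → ℤ} (h : π ∈ B n) : sortWeight π ≤ n * (n * n) := by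
  have : sortWeight π ≤ ∑ _i : Fin n, (n * n : ℤ) := by
    refine Finset.sum_le_sum fun i _ => ?_
    simp only [B, Finset.mem_filter, Fintype.mem_piFinset, Finset.mem_Icc] at h
    have h1 := (h.1 i).2
    have h2 : ((i : ℕ) + 1 : ℤ) ≤ n := by have := i.isLt; omega
    nlinarith
  simpa using this

lemma sortWeight_lt_swap {π : Fin n → ℤ} {i j : Fin n} (hij : (j : ℕ) = i + 1) (h : π j < π i) :
    sortWeight π < sortWeight (π ∘ Equiv.swap i j) := by
  have hne : i ≠ j := fun h => by rw [h] at hij; omega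
  have h1 : sortWeight (π ∘ Equiv.swap i j) - sortWeight π =
      ∑ a : Fin n, ((a : ℕ) + 1 : ℤ) * (π (Equiv.swap i j a) - π a) := by
    simp [sortWeight, mul_sub, Finset.sum_sub_distrib]
  have h2 : ∑ a : Fin n, ((a : ℕ) + 1 : ℤ) * (π (Equiv.swap i j a) - π a) = π i - π j := by
    rw [← Finset.sum_subset (Finset.subset_univ {i, j}), Finset.sum_pair hne]
    · simp [hij]; ring
    · intro a _ ha
      simp only [Finset.mem_insert, Finset.mem_singleton, not_or] at ha
      rw [Equiv.swap_apply_of_ne_of_ne ha.1 ha.2, sub_self, mul_zero]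
  linarith

lemma sortWeight_lt_update {π : Fin n → ℤ} {i : Fin n} (h : π i < 0) :
    sortWeight π < sortWeight (Function.update π i (-π i)) := by
  refine Finset.sum_lt_sum (fun a _ => ?_) ⟨i, Finset.mem_univ i, ?_⟩
  · rcases eq_or_ne a i with rfl | hne
    · rw [Function.update_self]
      exact mul_le_mul_of_nonneg_left (by omega) (by positivity)
    · rw [Function.update_of_ne hne]
  · rw [Function.update_self]
    exact mul_lt_mul_of_pos_left (by omega) (by positivity)

/-- Sorting by generators: a word that is not the identity has an adjacent inversion or a negative
first letter, and removing it increases the bounded integer `sortWeight`. Without this, the infimum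
in `lengthB` could be the default value `0` of an empty set. -/
lemma exists_isProduct {π : Fin n → ℤ} (h : π ∈ B n) : ∃ m, IsProduct m π := by
  induction hN : (n * (n * n) - sortWeight π).toNat using Nat.strong_induction_on
    generalizing π with
  | _ N ih =>
    by_cases h0 : ∀ i : Fin n, (i : ℕ) = 0 → 0 < π i
    · by_cases h1 : ∀ i j : Fin n, (j : ℕ) = i + 1 → π i < π j
      · exact ⟨0, eq_id_of_monotone h h0 h1 ▸ IsProduct.one⟩
      · push Not at h1
        obtain ⟨i, j, hij, hle⟩ := h1
        have hne : π j ≠ π i := fun he => by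
          obtain ⟨s, τ, rfl⟩ := exists_word_of_mem_B h
          have := congrArg Int.natAbs he
          rw [natAbs_word, natAbs_word, add_left_inj, Fin.val_inj, τ.apply_eq_iff_eq] at this
          rw [this] at hij
          omega
        have hw := sortWeight_lt_swap hij (lt_of_le_of_ne hle hne)
        have hB := comp_swap_mem_B h i j
        have := sortWeight_le hB
        obtain ⟨m, hm⟩ := ih _ (by omega) hB rfl
        refine ⟨m + 1, ?_⟩
        -- The generators are involutions, so applying the same one again recovers `π`.
        have := IsProduct.mul_swap i j hij hm
        rwa [Function.comp_assoc, ← Equiv.Perm.coe_mul, Equiv.swap_mul_self, Equiv.Perm.coe_one,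
          Function.comp_id] at this
    · push Not at h0
      obtain ⟨i, hi, hle⟩ := h0
      have hne : π i ≠ 0 := fun he => by
        obtain ⟨s, τ, rfl⟩ := exists_word_of_mem_B h
        have := natAbs_word s τ i
        omega
      have hw := sortWeight_lt_update (lt_of_le_of_ne hle hne)
      have hB := update_neg_mem_B h i
      have := sortWeight_le hB
      obtain ⟨m, hm⟩ := ih _ (by omega) hB rfl
      refine ⟨m + 1, ?_⟩
      have := IsProduct.mul_neg i hi hm
      simpa using this

lemma neg_one_pow_lengthB (s : Fin n → ℤˣ) (τ : Equiv.Perm (Fin n)) :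
    (-1 : ℤˣ) ^ lengthB (word s τ) = wordSign s τ := by
  have h : IsProduct (lengthB (word s τ)) (word s τ) :=
    Nat.sInf_mem (s := {m | IsProduct m (word s τ)}) (exists_isProduct (word_mem_B s τ))
  obtain ⟨s', τ', he, hs⟩ := h.exists_word
  obtain ⟨rfl, rfl⟩ := word_injective he
  exact hs.symm

end Word

/-! ### Inflation of a signed derangement -/

/-- The position `j` of `σ` carries a letter below `j` (positions being counted from `1`). -/
def IsSubcedant {k : ℕ} (σ : Fin k → ℤ) (j : ℕ) : Prop :=
  ∃ h : j < k, σ ⟨j, h⟩ < (j : ℤ) + 1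

/-- The word `σ` has a descent at the position `j`. -/
def IsDescent {k : ℕ} (σ : Fin k → ℤ) (j : ℕ) : Prop :=
  ∃ h : j + 1 < k, Prec (σ ⟨j + 1, h⟩) (σ ⟨j, by omega⟩)

open Classical in
lemma maj_eq_prefixMaj {k : ℕ} (σ : Fin (k + 1) → ℤ) : maj σ = prefixMaj (IsDescent σ) k := by
  have h : maj σ = ∑ i : Fin (k + 1), if IsDescent σ (i : ℕ) then (i : ℕ) + 1 else 0 := by
    rw [maj, desSet, Finset.sum_filter]
    exact Finset.sum_congr rfl fun i _ => if_congr Iff.rfl rfl rfl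
  rw [h, Fin.sum_univ_eq_sum_range (fun i => if IsDescent σ i then i + 1 else 0) (k + 1),
    Finset.sum_range_succ, prefixMaj, if_neg, add_zero]
  rintro ⟨h, -⟩
  omega

section Inflate

variable {n k : ℕ} (S : Finset (Fin n)) (h : S.card = k) (s : Fin k → ℤˣ)
  (τ : Equiv.Perm (Fin k))

/-- The signs `s` placed on the positions in `S`. -/
def inflateSign (j : Fin n) : ℤˣ :=
  if hj : j ∈ S then s ((S.orderIsoOfFin h).symm ⟨j, hj⟩) else 1

/-- The permutation `τ` acting on the positions in `S`. -/
def inflatePerm : Equiv.Perm (Fin n) :=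
  τ.extendDomain (S.orderIsoOfFin h).toEquiv

/-- The signed permutation which acts as `word s τ` on `S` and fixes the other positions. -/
def inflate : Fin n → ℤ := word (inflateSign S h s) (inflatePerm S h τ)

lemma inflateSign_emb (a : Fin k) : inflateSign S h s (S.orderEmbOfFin h a) = s a := by
  rw [inflateSign, dif_pos (Finset.orderEmbOfFin_mem S h a)]
  congr 1
  rw [OrderIso.symm_apply_eq]
  rfl

lemma inflatePerm_emb (a : Fin k) :
    inflatePerm S h τ (S.orderEmbOfFin h a) = S.orderEmbOfFin h (τ a) :=
  Equiv.Perm.extendDomain_apply_image τ (S.orderIsoOfFin h).toEquiv a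

lemma inflate_emb (a : Fin k) :
    inflate S h s τ (S.orderEmbOfFin h a) =
      (s a : ℤ) * (((S.orderEmbOfFin h (τ a) : Fin n) : ℕ) + 1 : ℤ) := by
  rw [inflate, word, inflateSign_emb, inflatePerm_emb]

lemma inflate_of_notMem {j : Fin n} (hj : j ∉ S) : inflate S h s τ j = ((j : ℕ) : ℤ) + 1 := by
  rw [inflate, word, inflateSign, dif_neg hj, inflatePerm,
    Equiv.Perm.extendDomain_apply_not_subtype τ _ hj]
  simp

lemma exists_orderEmbOfFin_eq {j : Fin n} (hj : j ∈ S) : ∃ a, S.orderEmbOfFin h a = j := by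
  have : j ∈ Set.range (S.orderEmbOfFin h) := by rw [Finset.range_orderEmbOfFin]; exact hj
  exact this

lemma wordSign_inflate :
    wordSign (inflateSign S h s) (inflatePerm S h τ) = wordSign s τ := by
  rw [wordSign, wordSign, inflatePerm, Equiv.Perm.sign_extendDomain]
  congr 1
  have h1 : ∏ j ∈ Finset.univ.map (S.orderEmbOfFin h).toEmbedding, inflateSign S h s j =
      ∏ a, s a := by
    rw [Finset.prod_map]
    exact Finset.prod_congr rfl fun a _ => inflateSign_emb S h s a
  rw [← h1, Finset.map_orderEmbOfFin_univ]
  exact (Finset.prod_subset (Finset.subset_univ S) fun j _ hj => dif_neg hj).symm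

lemma neg_inflate : neg (inflate S h s τ) = neg (word s τ) := by
  have : negSet (inflate S h s τ) =
      (negSet (word s τ)).map (S.orderEmbOfFin h).toEmbedding := by
    ext j
    simp only [negSet, Finset.mem_filter, Finset.mem_univ, true_and, Finset.mem_map,
      RelEmbedding.coe_toEmbedding]
    have key (a : Fin k) : inflate S h s τ (S.orderEmbOfFin h a) < 0 ↔ word s τ a < 0 := by
      rw [← Int.sign_eq_neg_one_iff_neg, ← Int.sign_eq_neg_one_iff_neg, sign_word, inflate,
        sign_word, inflateSign_emb]
    constructor
    · intro hj
      by_cases hS : j ∈ S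
      · obtain ⟨a, rfl⟩ := exists_orderEmbOfFin_eq S h hS
        exact ⟨a, (key a).1 hj, rfl⟩
      · rw [inflate_of_notMem S h s τ hS] at hj
        omega
    · rintro ⟨a, ha, rfl⟩
      exact (key a).2 ha
  rw [neg, this, Finset.card_map, neg]

lemma isFixed_word_iff (i : Fin k) : IsFixed (word s τ) i ↔ s i = 1 ∧ τ i = i := by
  rw [IsFixed, word]
  rcases Int.units_eq_one_or (s i) with hs | hs <;> simp [hs, Fin.ext_iff]
  omega

lemma isFixed_inflate_emb (a : Fin k) :
    IsFixed (inflate S h s τ) (S.orderEmbOfFin h a) ↔ IsFixed (word s τ) a := by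
  rw [inflate, isFixed_word_iff, isFixed_word_iff, inflateSign_emb, inflatePerm_emb,
    EmbeddingLike.apply_eq_iff_eq]

variable {s τ}

lemma isFixed_inflate_iff (hd : ∀ a, ¬ IsFixed (word s τ) a) (j : Fin n) :
    IsFixed (inflate S h s τ) j ↔ j ∉ S := by
  by_cases hj : j ∈ S
  · obtain ⟨a, rfl⟩ := exists_orderEmbOfFin_eq S h hj
    simp [isFixed_inflate_emb, hd, hj]
  · simp [hj, IsFixed, inflate_of_notMem]

lemma filter_finRange_eq_map_orderEmbOfFin :
    (List.finRange n).filter (fun i => decide (i ∈ S)) =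
      (List.finRange k).map (S.orderEmbOfFin h) := by
  refine List.Pairwise.eq_of_mem_iff (r := (· < ·))
    ((List.sortedLT_finRange n).pairwise.filter _) ?_ fun j => ?_
  · rw [List.pairwise_map]
    exact (List.sortedLT_finRange k).pairwise.imp fun hab => (S.orderEmbOfFin h).strictMono hab
  · simp only [List.mem_filter, List.mem_finRange, true_and, decide_eq_true_eq, List.mem_map]
    exact ⟨exists_orderEmbOfFin_eq S h, fun ⟨a, ha⟩ => ha ▸ Finset.orderEmbOfFin_mem S h a⟩

lemma countP_finRange_le (a : Fin k) :
    (List.finRange k).countP (fun b => decide (τ b ≤ τ a)) = (τ a : ℕ) + 1 := by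
  have h1 : (List.finRange k).countP (fun b => decide (τ b ≤ τ a)) =
      (Finset.univ.filter fun b => τ b ≤ τ a).card := by
    rw [List.countP_eq_length_filter, ← List.toFinset_card_of_nodup
      ((List.nodup_finRange k).filter _)]
    congr 1
    ext b
    simp
  have h2 : (Finset.univ.filter fun b => τ b ≤ τ a) =
      (Finset.Iic (τ a)).map τ.symm.toEmbedding := by
    ext b
    simp
  rw [h1, h2, Finset.card_map, Fin.card_Iic]

/-- The non-fixed positions are exactly `S`, and an increasing embedding preserves the ranks of
absolute values, so reduction undoes the transport. -/
lemma dp_inflate (hd : ∀ a, ¬ IsFixed (word s τ) a) :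
    dp (inflate S h s τ) = List.ofFn (word s τ) := by
  have h1 : nonFixedSubword (inflate S h s τ) =
      (List.finRange k).map fun a => inflate S h s τ (S.orderEmbOfFin h a) := by
    rw [nonFixedSubword]
    simp only [isFixed_inflate_iff S h hd, not_not]
    rw [filter_finRange_eq_map_orderEmbOfFin S h, List.map_map]
    rfl
  rw [dp, h1, reduction, List.map_map, List.ofFn_eq_map]
  refine List.map_congr_left fun a _ => ?_
  simp only [Function.comp_apply, List.countP_map]
  have h2 : ((fun b : ℤ => decide (b.natAbs ≤ (inflate S h s τ (S.orderEmbOfFin h a)).natAbs)) ∘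
      fun b => inflate S h s τ (S.orderEmbOfFin h b)) = fun b => decide (τ b ≤ τ a) := by
    funext b
    simp only [Function.comp_apply, inflate, natAbs_word, inflatePerm_emb, add_le_add_iff_right,
      Fin.val_fin_le, OrderEmbedding.le_iff_le]
  rw [h2, countP_finRange_le, inflate, sign_word, inflateSign_emb, word]
  push_cast
  rfl

/-- Every signed permutation is the inflation of its restriction to a set of positions
containing the non-fixed ones. -/
lemma exists_eq_inflate {π : Fin n → ℤ} (hπ : π ∈ B n) (hS : ∀ j, j ∉ S → IsFixed π j) :
    ∃ s τ, π = inflate S h s τ := by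
  obtain ⟨t, ρ, rfl⟩ := exists_word_of_mem_B hπ
  have hf (j : Fin n) (hj : j ∉ S) : t j = 1 ∧ ρ j = j := (isFixed_word_iff t ρ j).1 (hS j hj)
  have hρ (j : Fin n) : ρ j ∈ S ↔ j ∈ S := by
    refine ⟨fun hj => ?_, fun hj => ?_⟩ <;> by_contra hn
    · exact hn ((hf j hn).2 ▸ hj)
    · exact hn ((ρ.injective (hf _ hn).2).symm ▸ hj)
  let f := (S.orderIsoOfFin h).toEquiv
  let τ : Equiv.Perm (Fin k) := (f.trans (ρ.subtypePerm hρ)).trans f.symm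
  have hτ (a : Fin k) : S.orderEmbOfFin h (τ a) = ρ (S.orderEmbOfFin h a) :=
    congrArg Subtype.val (f.apply_symm_apply (ρ.subtypePerm hρ (f a)))
  refine ⟨t ∘ S.orderEmbOfFin h, τ, funext fun j => ?_⟩
  by_cases hj : j ∈ S
  · obtain ⟨a, rfl⟩ := exists_orderEmbOfFin_eq S h hj
    rw [inflate_emb, hτ]
    rfl
  · rw [inflate_of_notMem S h _ _ hj]
    exact hS j hj

lemma mem_map_valEmbedding {i : ℕ} (hi : i < n) :
    i ∈ S.map Fin.valEmbedding ↔ (⟨i, hi⟩ : Fin n) ∈ S := by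
  simp only [Finset.mem_map, Fin.valEmbedding_apply]
  constructor
  · rintro ⟨j, hj, rfl⟩; exact hj
  · exact fun hj => ⟨_, hj, rfl⟩

lemma card_filter_lt_orderEmbOfFin (a : Fin k) :
    ((S.map Fin.valEmbedding).filter (· < (S.orderEmbOfFin h a : ℕ))).card = a := by
  have : (S.map Fin.valEmbedding).filter (· < (S.orderEmbOfFin h a : ℕ)) =
      ((Finset.Iio a).map (S.orderEmbOfFin h).toEmbedding).map Fin.valEmbedding := by
    ext i
    simp only [Finset.mem_filter, Finset.mem_map, Fin.valEmbedding_apply,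
      RelEmbedding.coe_toEmbedding, Finset.mem_Iio]
    constructor
    · rintro ⟨⟨j, hj, rfl⟩, hlt⟩
      obtain ⟨b, rfl⟩ := exists_orderEmbOfFin_eq S h hj
      exact ⟨_, ⟨b, (S.orderEmbOfFin h).lt_iff_lt.1 hlt, rfl⟩, rfl⟩
    · rintro ⟨j, ⟨b, hb, rfl⟩, rfl⟩
      exact ⟨⟨_, Finset.orderEmbOfFin_mem S h b, rfl⟩, (S.orderEmbOfFin h).lt_iff_lt.2 hb⟩
  rw [this, Finset.card_map, Finset.card_map, Fin.card_Iio]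

lemma val_succ_of_orderEmbOfFin_succ {a b : Fin k}
    (hab : (S.orderEmbOfFin h b : ℕ) = S.orderEmbOfFin h a + 1) : (b : ℕ) = a + 1 := by
  have h1 : a < b := (S.orderEmbOfFin h).lt_iff_lt.1 (Fin.lt_def.2 (by omega))
  by_contra hne
  have h1' := Fin.lt_def.1 h1
  let c : Fin k := ⟨a + 1, by omega⟩
  have h2 : S.orderEmbOfFin h a < S.orderEmbOfFin h c :=
    (S.orderEmbOfFin h).lt_iff_lt.2 (Fin.lt_def.2 (Nat.lt_succ_self _))
  have h3 : S.orderEmbOfFin h c < S.orderEmbOfFin h b :=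
    (S.orderEmbOfFin h).lt_iff_lt.2 (Fin.lt_def.2 (show (a : ℕ) + 1 < b by omega))
  rw [Fin.lt_def] at h2 h3
  omega

lemma isSubcedant_word_iff (a : Fin k) :
    IsSubcedant (word s τ) a ↔ s a = -1 ∨ S.orderEmbOfFin h (τ a) < S.orderEmbOfFin h a := by
  rw [OrderEmbedding.lt_iff_lt, Fin.lt_def]
  have h1 : IsSubcedant (word s τ) a ↔ word s τ a < ((a : ℕ) : ℤ) + 1 :=
    ⟨fun ⟨_, h⟩ => h, fun h => ⟨a.isLt, h⟩⟩
  rw [h1, word]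
  rcases Int.units_eq_one_or (s a) with hs | hs <;> simp [hs]
  omega

/-- Being above or below the diagonal is unaffected by an increasing embedding applied to both
positions and values. -/
lemma not_isSubcedant_word_iff (hd : ∀ a, ¬ IsFixed (word s τ) a) (a : Fin k) :
    ¬ IsSubcedant (word s τ) a ↔ s a = 1 ∧ S.orderEmbOfFin h a < S.orderEmbOfFin h (τ a) := by
  rw [isSubcedant_word_iff S h]
  have h2 := hd a
  rw [isFixed_word_iff] at h2
  rcases Int.units_eq_one_or (s a) with hs | hs
  · have hne : S.orderEmbOfFin h (τ a) ≠ S.orderEmbOfFin h a := fun he =>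
      h2 ⟨hs, (S.orderEmbOfFin h).injective he⟩
    simp only [hs, true_and, not_or, not_lt]
    exact ⟨fun hh => lt_of_le_of_ne hh.2 hne.symm, fun hh => ⟨by decide, hh.le⟩⟩
  · simp [hs]

lemma prec_units_mul (u v : ℤˣ) (x y : ℕ) :
    Prec ((u : ℤ) * (x + 1)) ((v : ℤ) * (y + 1)) ↔
      (u = -1 ∧ v = -1 ∧ x < y) ∨ (u = -1 ∧ v = 1) ∨ (u = 1 ∧ v = 1 ∧ x < y) := by
  have h1 : (1 : ℤˣ) ≠ -1 := by decide
  rcases Int.units_eq_one_or u with rfl | rfl <;> rcases Int.units_eq_one_or v with rfl | rfl <;>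
    simp [Prec, h1, h1.symm] <;> omega

/-- Two adjacent positions of `S` come from adjacent positions of `σ`. If only one of the two is in
`S`, its letter cannot have the absolute value of the neighbouring fixed point, so comparing it with
that fixed point amounts to comparing it with its own position. -/
lemma prec_inflate_iff (hd : ∀ a, ¬ IsFixed (word s τ) a) {i : ℕ} (hi : i + 1 < n) :
    Prec (inflate S h s τ ⟨i + 1, hi⟩) (inflate S h s τ ⟨i, by omega⟩) ↔
      PatternDescent (IsSubcedant (word s τ)) (IsDescent (word s τ)) (S.map Fin.valEmbedding) i := by
  have hi' : i < n := by omega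
  have h1 : (1 : ℤˣ) ≠ -1 := by decide
  rw [PatternDescent, mem_map_valEmbedding S hi, mem_map_valEmbedding S hi']
  by_cases m1 : (⟨i, hi'⟩ : Fin n) ∈ S <;> by_cases m2 : (⟨i + 1, hi⟩ : Fin n) ∈ S <;>
    simp only [m1, m2, true_and, false_and, not_true, not_false_iff, or_false, false_or]
  · obtain ⟨a, ha⟩ := exists_orderEmbOfFin_eq S h m1
    obtain ⟨b, hb⟩ := exists_orderEmbOfFin_eq S h m2
    have ha' : (S.orderEmbOfFin h a : ℕ) = i := by rw [ha]
    have hab := val_succ_of_orderEmbOfFin_succ S h (a := a) (b := b) (by rw [ha, hb])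
    have hr := card_filter_lt_orderEmbOfFin S h a
    rw [ha'] at hr
    have hdes : IsDescent (word s τ) a ↔ Prec (word s τ b) (word s τ a) := by
      have hb' : b = ⟨a + 1, hab ▸ b.isLt⟩ := Fin.ext hab
      rw [hb']
      exact ⟨fun ⟨_, h⟩ => h, fun h => ⟨_, h⟩⟩
    rw [hr, hdes, ← ha, ← hb, inflate_emb, inflate_emb, word, word, prec_units_mul,
      prec_units_mul, Fin.val_fin_lt, OrderEmbedding.lt_iff_lt, Fin.lt_def]
  · obtain ⟨a, ha⟩ := exists_orderEmbOfFin_eq S h m1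
    have ha' : (S.orderEmbOfFin h a : ℕ) = i := by rw [ha]
    have hr := card_filter_lt_orderEmbOfFin S h a
    rw [ha'] at hr
    have hne : (S.orderEmbOfFin h (τ a) : ℕ) ≠ i + 1 := fun he =>
      m2 ((Fin.ext he : _ = (⟨i + 1, hi⟩ : Fin n)) ▸ Finset.orderEmbOfFin_mem S h _)
    have hp := prec_units_mul 1 (s a) (i + 1) (S.orderEmbOfFin h (τ a))
    rw [Units.val_one, one_mul] at hp
    rw [hr, not_isSubcedant_word_iff S h hd, inflate_of_notMem S h s τ m2, ← ha, inflate_emb, hp,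
      Fin.lt_def, ha']
    simp only [h1, false_and, false_or, true_and]
    exact and_congr_right fun _ => by omega
  · obtain ⟨a, ha⟩ := exists_orderEmbOfFin_eq S h m2
    have ha' : (S.orderEmbOfFin h a : ℕ) = i + 1 := by rw [ha]
    have hr := card_filter_lt_orderEmbOfFin S h a
    -- As `i` is not in `S`, the rank of `i + 1` in `S` is already counted by the elements below
    -- `i`.
    have hr' : ((S.map Fin.valEmbedding).filter (· < i)).card = a := by
      rw [← hr, ha']
      congr 1
      refine Finset.filter_congr fun j hj => ?_
      have : j ≠ i := by rintro rfl; exact m1 ((mem_map_valEmbedding S hi').1 hj)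
      omega
    have hne : (S.orderEmbOfFin h (τ a) : ℕ) ≠ i := fun he =>
      m1 ((Fin.ext he : _ = (⟨i, hi'⟩ : Fin n)) ▸ Finset.orderEmbOfFin_mem S h _)
    have hp := prec_units_mul (s a) 1 (S.orderEmbOfFin h (τ a)) i
    rw [Units.val_one, one_mul] at hp
    rw [hr', isSubcedant_word_iff S h, inflate_of_notMem S h s τ m1, ← ha, inflate_emb, hp,
      Fin.lt_def, ha']
    rcases Int.units_eq_one_or (s a) with hs | hs <;> simp [hs, h1, h1.symm]
    omega
  · rw [inflate_of_notMem S h s τ m1, inflate_of_notMem S h s τ m2, Prec, iff_false]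
    push_cast
    omega

end Inflate

open Classical in
lemma maj_inflate {n k : ℕ} (S : Finset (Fin (n + 1))) (h : S.card = k) {s : Fin k → ℤˣ}
    {τ : Equiv.Perm (Fin k)} (hd : ∀ a, ¬ IsFixed (word s τ) a) :
    maj (inflate S h s τ) =
      patternMaj (IsSubcedant (word s τ)) (IsDescent (word s τ)) n (S.map Fin.valEmbedding) := by
  rw [maj_eq_prefixMaj, prefixMaj, patternMaj]
  refine Finset.sum_congr rfl fun i hi => if_congr ?_ rfl rfl
  have hi' : i + 1 < n + 1 := by simpa using hi
  rw [← prec_inflate_iff S h hd hi']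
  exact ⟨fun ⟨_, h⟩ => h, fun h => ⟨hi', h⟩⟩


section Derangement

variable {k : ℕ} {σ : Fin k → ℤ}

/-- With no fixed point, the letter at `j` exceeds its position, hence is at least the next
position, while the next letter is below that position. -/
lemma isDescent_of_not_isSubcedant (hd : ∀ a, ¬ IsFixed σ a) {j : ℕ} (hj : j + 1 < k)
    (h1 : ¬ IsSubcedant σ j) (h2 : IsSubcedant σ (j + 1)) : IsDescent σ j := by
  obtain ⟨_, h2⟩ := h2
  have h3 : ¬ σ ⟨j, by omega⟩ < (j : ℤ) + 1 := fun h => h1 ⟨_, h⟩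
  have h4 : σ ⟨j, by omega⟩ ≠ (j : ℤ) + 1 := hd _
  refine ⟨hj, ?_⟩
  rw [Prec]
  push_cast at h2
  omega

lemma not_isDescent_of_isSubcedant {j : ℕ} (hj : j + 1 < k)
    (h1 : IsSubcedant σ j) (h2 : ¬ IsSubcedant σ (j + 1)) : ¬ IsDescent σ j := by
  obtain ⟨_, h1⟩ := h1
  have h3 : ¬ σ ⟨j + 1, hj⟩ < ((j + 1 : ℕ) : ℤ) + 1 := fun h => h2 ⟨_, h⟩
  rintro ⟨_, h⟩
  rw [Prec] at h
  push_cast at h3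
  omega

end Derangement

/-! ### The fiber of the derangement part -/

/-- The set of positions of a word of length `n + 1` given by `S` and the last position. -/
def withLast (n : ℕ) (S : Finset ℕ) : Finset (Fin (n + 1)) :=
  Finset.univ.filter fun j => (j : ℕ) ∈ insert n S

lemma map_withLast {n : ℕ} {S : Finset ℕ} (hS : S ⊆ Finset.range n) :
    (withLast n S).map Fin.valEmbedding = insert n S := by
  ext i
  simp only [withLast, Finset.mem_map, Finset.mem_filter, Finset.mem_univ, true_and,
    Fin.valEmbedding_apply]
  refine ⟨fun ⟨j, hj, hi⟩ => hi ▸ hj, fun hi => ⟨⟨i, ?_⟩, hi, rfl⟩⟩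
  rcases Finset.mem_insert.1 hi with rfl | hi
  · omega
  · have := Finset.mem_range.1 (hS hi); omega

lemma card_withLast {n k : ℕ} {S : Finset ℕ} (hS : S ∈ Finset.powersetCard k (Finset.range n)) :
    (withLast n S).card = k + 1 := by
  obtain ⟨h1, h2⟩ := Finset.mem_powersetCard.1 hS
  rw [← Finset.card_map Fin.valEmbedding, map_withLast h1,
    Finset.card_insert_of_notMem fun h => by simpa using h1 h, h2]

lemma withLast_injOn {n : ℕ} {S T : Finset ℕ} (hS : S ⊆ Finset.range n)
    (hT : T ⊆ Finset.range n) (h : withLast n S = withLast n T) : S = T := by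
  have h' := map_withLast hS
  rw [h, map_withLast hT] at h'
  rw [← Finset.erase_insert (fun hh => by simpa using hS hh : n ∉ S), ← h',
    Finset.erase_insert (fun hh => by simpa using hT hh : n ∉ T)]

lemma last_mem_withLast (n : ℕ) (S : Finset ℕ) : Fin.last n ∈ withLast n S := by
  simp [withLast]

lemma exists_eq_withLast {n k : ℕ} {T : Finset (Fin (n + 1))} (hc : T.card = k + 1)
    (hT : Fin.last n ∈ T) :
    ∃ S ∈ Finset.powersetCard k (Finset.range n), T = withLast n S := by
  have hmem : n ∈ T.map Fin.valEmbedding := Finset.mem_map.2 ⟨_, hT, rfl⟩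
  refine ⟨(T.map Fin.valEmbedding).erase n, Finset.mem_powersetCard.2 ⟨fun i hi => ?_, ?_⟩, ?_⟩
  · obtain ⟨h1, h2⟩ := Finset.mem_erase.1 hi
    obtain ⟨j, -, rfl⟩ := Finset.mem_map.1 h2
    have := j.isLt
    rw [Fin.valEmbedding_apply] at h1 ⊢
    rw [Finset.mem_range]
    omega
  · rw [Finset.card_erase_of_mem hmem, Finset.card_map, hc, Nat.add_sub_cancel]
  · ext j
    rw [withLast, Finset.insert_erase hmem, Finset.mem_filter, mem_map_valEmbedding T j.isLt]
    simp

section Fiber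

variable {n k : ℕ} {s : Fin (k + 1) → ℤˣ} {τ : Equiv.Perm (Fin (k + 1))}

lemma inflate_mem_fiber (hd : ∀ a, ¬ IsFixed (word s τ) a) (hl : s (Fin.last k) = 1)
    {T : Finset (Fin (n + 1))} (hc : T.card = k + 1) (hT : Fin.last n ∈ T) :
    inflate T hc s τ ∈ (deltaLt (n + 1)).filter fun π => dp π = List.ofFn (word s τ) := by
  refine Finset.mem_filter.2 ⟨Finset.mem_filter.2 ⟨word_mem_B _ _, Fin.last n, rfl, ?_⟩,
    dp_inflate T hc hd⟩
  have hlast : T.orderEmbOfFin hc (Fin.last k) = Fin.last n := by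
    obtain ⟨a, ha⟩ := exists_orderEmbOfFin_eq T hc hT
    exact le_antisymm (Fin.le_last _) (ha ▸ (T.orderEmbOfFin hc).monotone (Fin.le_last a))
  -- The last letter has the sign of the last letter of `σ`, and it is not the largest value because
  -- the last position is not fixed.
  have hne := (isFixed_inflate_iff T hc hd (Fin.last n)).not.2 (not_not.2 hT)
  rw [IsFixed, ← hlast, inflate_emb, hl, hlast, Fin.val_last] at hne
  have hlt := (T.orderEmbOfFin hc (τ (Fin.last k))).isLt
  rw [← hlast, inflate_emb, hl]
  push_cast at hne ⊢
  omega

lemma length_nonFixedSubword {m : ℕ} (π : Fin m → ℤ) :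
    (nonFixedSubword π).length = (Finset.univ.filter fun i => ¬ IsFixed π i).card := by
  rw [nonFixedSubword, List.length_map, ← List.toFinset_card_of_nodup
    ((List.nodup_finRange m).filter _)]
  congr 1
  ext b
  simp

/-- The set is forced to be that of the non-fixed positions. The restriction of `π` to it is again a
derangement, with derangement part `word s τ`, so its signs and permutation are `s` and `τ`. -/
lemma exists_inflate_of_mem_fiber {π : Fin (n + 1) → ℤ}
    (hπ : π ∈ (deltaLt (n + 1)).filter fun π => dp π = List.ofFn (word s τ)) :
    ∃ (T : Finset (Fin (n + 1))) (hc : T.card = k + 1), Fin.last n ∈ T ∧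
      π = inflate T hc s τ := by
  obtain ⟨hπ, hdp⟩ := Finset.mem_filter.1 hπ
  obtain ⟨hB, i, hi, -, hlt⟩ := Finset.mem_filter.1 hπ
  obtain rfl : i = Fin.last n := Fin.ext (by rw [Fin.val_last]; omega)
  have hc : (Finset.univ.filter fun i => ¬ IsFixed π i).card = k + 1 := by
    have := congrArg List.length hdp
    rwa [dp, reduction, List.length_map, length_nonFixedSubword, List.length_ofFn] at this
  refine ⟨Finset.univ.filter fun i => ¬ IsFixed π i, hc, ?_, ?_⟩
  · rw [Finset.mem_filter, IsFixed, Fin.val_last]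
    push_cast at hlt
    exact ⟨Finset.mem_univ _, by omega⟩
  · obtain ⟨s', τ', he⟩ := exists_eq_inflate _ hc hB fun j hj => by simpa using hj
    have hd' (a : Fin (k + 1)) : ¬ IsFixed (word s' τ') a := by
      rw [← isFixed_inflate_emb _ hc, ← he]
      exact (Finset.mem_filter.1 (Finset.orderEmbOfFin_mem _ hc a)).2
    have hw := dp_inflate _ hc hd'
    rw [← he, hdp, List.ofFn_inj] at hw
    obtain ⟨rfl, rfl⟩ := word_injective hw
    exact he

lemma inflate_injective (hd : ∀ a, ¬ IsFixed (word s τ) a) {T U : Finset (Fin (n + 1))}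
    (hT : T.card = k + 1) (hU : U.card = k + 1) (h : inflate T hT s τ = inflate U hU s τ) :
    T = U := by
  ext j
  rw [← not_iff_not, ← isFixed_inflate_iff T hT hd, h, isFixed_inflate_iff U hU hd]

lemma sum_fiber_eq {M : Type*} [AddCommMonoid M] (hd : ∀ a, ¬ IsFixed (word s τ) a)
    (hl : s (Fin.last k) = 1) (f : (Fin (n + 1) → ℤ) → M) (g : Finset ℕ → M)
    (hfg : ∀ S (hS : S ∈ Finset.powersetCard k (Finset.range n)),
      g S = f (inflate (withLast n S) (card_withLast hS) s τ)) :
    ∑ π ∈ (deltaLt (n + 1)).filter (fun π => dp π = List.ofFn (word s τ)), f π =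
      ∑ S ∈ Finset.powersetCard k (Finset.range n), g S := by
  symm
  refine Finset.sum_bij (fun S hS => inflate (withLast n S) (card_withLast hS) s τ)
    (fun S hS => inflate_mem_fiber hd hl _ (last_mem_withLast n S)) (fun S hS T hT he => ?_)
    (fun π hπ => ?_) hfg
  · exact withLast_injOn (Finset.mem_powersetCard.1 hS).1 (Finset.mem_powersetCard.1 hT).1
      (inflate_injective hd _ _ he)
  · obtain ⟨T, hc, hT, rfl⟩ := exists_inflate_of_mem_fiber hπ
    obtain ⟨S, hS, rfl⟩ := exists_eq_withLast hc hT
    exact ⟨S, hS, rfl⟩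

end Fiber

/-- The two lengths may differ; only their parity matters. -/
lemma pow_lengthB_eq {R : Type*} [CommRing R] {ε : ℤ} (hε : ε = 1 ∨ ε = -1) {n k : ℕ}
    {s : Fin n → ℤˣ} {τ : Equiv.Perm (Fin n)} {s' : Fin k → ℤˣ} {τ' : Equiv.Perm (Fin k)}
    (h : wordSign s τ = wordSign s' τ') :
    (ε : R) ^ lengthB (word s τ) = (ε : R) ^ lengthB (word s' τ') := by
  rcases hε with rfl | rfl
  · simp
  · rw [← neg_one_pow_lengthB, ← neg_one_pow_lengthB] at h
    have := congrArg (fun u : ℤˣ => ((u : ℤ) : R)) h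
    simpa using this

end SignedMahonian


/-- The identity is one of polynomials in an indeterminate `q`; it is stated in `ℚ(q)`,
with `q = RatFunc.X`, where the quotient defining the `q²`-binomial coefficient makes sense. -/
theorem mainTheorem12 (ε : ℤ) (hε : ε = 1 ∨ ε = -1) (n k : ℕ) (hk : 1 ≤ k) (hkn : k ≤ n)
    (σ : Fin k → ℤ) (hσ : σ ∈ SignedMahonian.derangementsDelta k) :
    ∑ π ∈ (SignedMahonian.deltaLt n).filter (fun π => SignedMahonian.dp π = List.ofFn σ),
        (ε : RatFunc ℚ) ^ SignedMahonian.lengthB π *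
          (RatFunc.X : RatFunc ℚ) ^ SignedMahonian.fmaj π
      = (ε : RatFunc ℚ) ^ SignedMahonian.lengthB σ *
          (RatFunc.X : RatFunc ℚ) ^ (2 * (n - k) + SignedMahonian.fmaj σ) *
          SignedMahonian.qBinomial ((RatFunc.X : RatFunc ℚ) ^ 2) (n - 1) (k - 1) := by
  obtain ⟨k, rfl⟩ := Nat.exists_eq_add_of_le' hk
  obtain ⟨n, rfl⟩ := Nat.exists_eq_add_of_le' (hk.trans hkn)
  obtain ⟨hB, hd, i, hi, hpos⟩ := Finset.mem_filter.1 hσ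
  obtain rfl : i = Fin.last k := Fin.ext (by rw [Fin.val_last]; omega)
  obtain ⟨s, τ, rfl⟩ := SignedMahonian.exists_word_of_mem_B hB
  have hl : s (Fin.last k) = 1 := by
    rw [← Int.sign_eq_one_iff_pos, SignedMahonian.sign_word] at hpos
    exact Units.val_injective hpos
  -- The last letter is positive, at most `k + 1`, and not fixed. This selects the case of
  -- `endSums_eq` carrying the factor `q^(n-k)`.
  have hsub : SignedMahonian.IsSubcedant (SignedMahonian.word s τ) k := by
    have h1 := SignedMahonian.natAbs_word s τ (Fin.last k)
    have h2 : SignedMahonian.word s τ (Fin.last k) ≠ (k : ℤ) + 1 := hd (Fin.last k)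
    have h3 := (τ (Fin.last k)).isLt
    exact ⟨Nat.lt_succ_self k, show SignedMahonian.word s τ (Fin.last k) < (k : ℤ) + 1 by omega⟩
  rw [SignedMahonian.sum_fiber_eq hd hl _ (fun S =>
    (ε : RatFunc ℚ) ^ SignedMahonian.lengthB (SignedMahonian.word s τ) *
      RatFunc.X ^ SignedMahonian.neg (SignedMahonian.word s τ) *
      (RatFunc.X ^ 2) ^ SignedMahonian.patternMaj
        (SignedMahonian.IsSubcedant (SignedMahonian.word s τ))
        (SignedMahonian.IsDescent (SignedMahonian.word s τ)) n (insert n S))]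
  · have hsum := (SignedMahonian.endSums_eq (SignedMahonian.IsSubcedant (SignedMahonian.word s τ))
      (SignedMahonian.IsDescent (SignedMahonian.word s τ)) ((RatFunc.X : RatFunc ℚ) ^ 2) (k + 1)
      (fun j hj => SignedMahonian.isDescent_of_not_isSubcedant hd hj)
      (fun j hj => SignedMahonian.not_isDescent_of_isSubcedant hj) n).2 k (Nat.lt_succ_self k)
    rw [SignedMahonian.nonfixedEndSum, if_pos hsub, ← SignedMahonian.maj_eq_prefixMaj,
      SignedMahonian.gaussBinom_eq_qBinomial _ SignedMahonian.qInt_X_sq_ne_zero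
        (Nat.le_of_succ_le_succ hkn)] at hsum
    rw [← Finset.mul_sum, hsum, SignedMahonian.fmaj, Nat.add_sub_cancel, Nat.add_sub_cancel,
      Nat.add_sub_add_right]
    ring
  · intro S hS
    have hS' := (Finset.mem_powersetCard.1 hS).1
    rw [SignedMahonian.fmaj, SignedMahonian.neg_inflate, SignedMahonian.maj_inflate _ _ hd,
      SignedMahonian.map_withLast hS', SignedMahonian.inflate, SignedMahonian.pow_lengthB_eq hε
        (SignedMahonian.wordSign_inflate _ (SignedMahonian.card_withLast hS) s τ)]
    ring
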